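/- Let $N,K\in\mathbb{N}$. For $i=1,\dots,N$ let $\mathcal{X}_i\subset\mathbb{R}$ be non-empty and compact and let $\mu_i$ be a Borel probability measure on $\mathcal{X}_i$; put $\boldsymbol{\mathcal{X}}=\mathcal{X}_1\times\cdots\times\mathcal{X}_N$. Let $S_2^*\subset\mathbb{R}^K$ be a non-empty polytope (a bounded intersection of finitely many closed half-spaces), and let $\hat\mu_{\mathrm{aug}}$ be a Borel probability measure on $\boldsymbol{\mathcal{X}}\times S_2^*\subset\mathbb{R}^{N+K}$. For a Borel probability measure $\nu$ on $\boldsymbol{\mathcal{X}}\times S_2^*$, its distribution function is $F_\nu(z)=\nu\big(\{p:\ p_k\le z_k,\ k=1,\dots,N+K\}\big)$, $z\in\overline{\mathbb{R}}^{N+K}$; for $k=1,\dots,N+K$ let $F_{\hat\mu_k}(t)=\hat\mu_{\mathrm{aug}}(\{p:\ p_k\le t\})$, and for $i=1,\dots,N$ let $F_{\mu_i}(t)=\mu_i\big(\mathcal{X}_i\cap(-\infty,t]\big)$, $t\in\overline{\mathbb{R}}$. A copula is the distribution function $C:[0,1]^{N+K}\to[0,1]$ of a probability measure on $[0,1]^{N+K}$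 whose one-dimensional marginals are all uniform on $[0,1]$. Let $\hat\mu_i$ denote the marginal of $\hat\mu_{\mathrm{aug}}$ on $\mathcal{X}_i$, $i=1,\dots,N$, and let $W_1(\hat\mu_i,\mu_i)$ be the infimum of $\int|x-\bar x|\,\gamma_i(\mathrm{d}x,\mathrm{d}\bar x)$ over all couplings $\gamma_i$ of $\hat\mu_i$ and $\mu_i$. A Borel probability measure $\tilde\mu$ on $\boldsymbol{\mathcal{X}}\times S_2^*$ whose marginals on $\mathcal{X}_1,\dots,\mathcal{X}_N$ are $\mu_1,\dots,\mu_N$ is called a partial reassembly of $\hat\mu_{\mathrm{aug}}$ with marginals $\mu_1,\dots,\mu_N$ if there is a Borel probability measure $\gamma$ on $\boldsymbol{\mathcal{X}}\times\bar{\boldsymbol{\mathcal{X}}}\times S_2^*$, where $\bar{\boldsymbol{\mathcal{X}}}=\bar{\mathcal{X}}_1\times\cdots\times\bar{\mathcal{X}}_N$ is a copy of $\boldsymbol{\mathcal{X}}$, such that the marginal of $\gamma$ on $\boldsymbol{\mathcal{X}}\times S_2^*$ is $\hat\mu_{\mathrm{aug}}$; for each $i$ the marginal $\gamma_i$ of $\gamma$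 on $\mathcal{X}_i\times\bar{\mathcal{X}}_i$ is a coupling of $\hat\mu_i$ and $\mu_i$ with $\int|x-\bar x|\,\mathrm{d}\gamma_i=W_1(\hat\mu_i,\mu_i)$; and the marginal of $\gamma$ on $\bar{\boldsymbol{\mathcal{X}}}\times S_2^*$ is $\tilde\mu$. Then the following hold. (i) There exists a copula $C$ such that for all $z\in\overline{\mathbb{R}}^{N+K}$ $$F_{\hat\mu_{\mathrm{aug}}}(z)=C\big(F_{\hat\mu_1}(z_1),\dots,F_{\hat\mu_{N+K}}(z_{N+K})\big).$$ (ii) For every copula $C$ satisfying (i), there is a unique Borel probability measure $\tilde\mu_{\mathrm{aug}}$ on $\boldsymbol{\mathcal{X}}\times S_2^*$ such that for all $z\in\overline{\mathbb{R}}^{N+K}$ $$F_{\tilde\mu_{\mathrm{aug}}}(z)=C\big(F_{\mu_1}(z_1),\dots,F_{\mu_N}(z_N),F_{\hat\mu_{N+1}}(z_{N+1}),\dots,F_{\hat\mu_{N+K}}(z_{N+K})\big),$$ and this $\tilde\mu_{\mathrm{aug}}$ is a partial reassembly of $\hat\mu_{\mathrm{aug}}$ with marginals $\mu_1,\dots,\mu_N$.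 -/

import Mathlib

open MeasureTheory
open scoped ENNReal

noncomputable section

/-- A polytope in `ℝ^K`: a bounded intersection of finitely many closed half-spaces. -/
def IsPolytope {K : ℕ} (S : Set (Fin K → ℝ)) : Prop :=
  (∃ (m : ℕ) (A : Matrix (Fin m) (Fin K) ℝ) (b : Fin m → ℝ), S = {v | A.mulVec v ≤ b}) ∧
    Bornology.IsBounded S

/-- The space `X₁ × ⋯ × X_N × S`, as a product of subspaces of `ℝ, …, ℝ, ℝ^K`. -/
abbrev AugSpace {N K : ℕ} (X : Fin N → Set ℝ) (S : Set (Fin K → ℝ)) : Type :=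
  (∀ i, X i) × S

/-- The `N + K` real coordinates `(x₁, …, x_N, l₁, …, l_K)` of a point of `X₁ × ⋯ × X_N × S`. -/
def augCoord {N K : ℕ} {X : Fin N → Set ℝ} {S : Set (Fin K → ℝ)} (p : AugSpace X S) :
    Fin N ⊕ Fin K → ℝ :=
  Sum.elim (fun i => (p.1 i : ℝ)) (fun j => (p.2 : Fin K → ℝ) j)

/-- The probability of an event, as an element of `[0,1]`. -/
def probUnit {Ω : Type*} [MeasurableSpace Ω] (P : ProbabilityMeasure Ω) (E : Set Ω) : unitInterval :=
  ⟨(P : Measure Ω).real E, measureReal_nonneg, measureReal_le_one⟩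

/-- The distribution function, on extended real arguments, of a probability measure on
`X₁ × ⋯ × X_N × S`. -/
def jointDistFun {N K : ℕ} {X : Fin N → Set ℝ} {S : Set (Fin K → ℝ)}
    (P : ProbabilityMeasure (AugSpace X S)) (z : Fin N ⊕ Fin K → EReal) : unitInterval :=
  probUnit P {p | ∀ k, (augCoord p k : EReal) ≤ z k}

/-- The distribution function of the `k`-th one-dimensional marginal of a probability measure on
`X₁ × ⋯ × X_N × S`. -/
def marginalDistFun {N K : ℕ} {X : Fin N → Set ℝ} {S : Set (Fin K → ℝ)}
    (P : ProbabilityMeasure (AugSpace X S)) (k : Fin N ⊕ Fin K) (z : EReal) : unitInterval :=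
  probUnit P {p | (augCoord p k : EReal) ≤ z}

/-- The distribution function of a probability measure on a subset of `ℝ`. -/
def distFun {Y : Set ℝ} (ν : ProbabilityMeasure Y) (z : EReal) : unitInterval :=
  probUnit ν {y | ((y : ℝ) : EReal) ≤ z}

/-- A copula: the distribution function of a probability measure on `[0,1]^ι` all of whose
one-dimensional marginals are uniform on `[0,1]`. -/
def IsCopula {ι : Type*} (C : (ι → unitInterval) → unitInterval) : Prop :=
  ∃ P : ProbabilityMeasure (ι → unitInterval),
    (∀ k, (P : Measure (ι → unitInterval)).map (fun v => v k) = volume) ∧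
      ∀ u, C u = probUnit P {v | ∀ k, v k ≤ u k}

/-- `C` is a copula which recovers the distribution function of `P` from its marginals. -/
def IsCopulaOf {N K : ℕ} {X : Fin N → Set ℝ} {S : Set (Fin K → ℝ)}
    (C : (Fin N ⊕ Fin K → unitInterval) → unitInterval)
    (P : ProbabilityMeasure (AugSpace X S)) : Prop :=
  IsCopula C ∧ ∀ z, jointDistFun P z = C (fun k => marginalDistFun P k (z k))

/-- The composition of `C` with the distribution functions of `μ₁, …, μ_N` in the first `N`
coordinates and those of the marginals of `P` in the last `K` coordinates. -/
def reassembledDistFun {N K : ℕ} {X : Fin N → Set ℝ} {S : Set (Fin K → ℝ)}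
    (C : (Fin N ⊕ Fin K → unitInterval) → unitInterval)
    (μ : ∀ i, ProbabilityMeasure (X i)) (P : ProbabilityMeasure (AugSpace X S))
    (z : Fin N ⊕ Fin K → EReal) : unitInterval :=
  C (Sum.elim (fun i => distFun (μ i) (z (Sum.inl i)))
    (fun j => marginalDistFun P (Sum.inr j) (z (Sum.inr j))))

/-- The set of couplings of `μ` and `ν`. -/
def couplings {Y : Set ℝ} (μ ν : Measure Y) : Set (Measure (Y × Y)) :=
  {γ | IsProbabilityMeasure γ ∧ γ.map Prod.fst = μ ∧ γ.map Prod.snd = ν}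

/-- The integral of `|x - y|`, with values in `[0, ∞]`. -/
def transportCost {Y : Set ℝ} (γ : Measure (Y × Y)) : ℝ≥0∞ :=
  ∫⁻ p, ENNReal.ofReal |(p.1 : ℝ) - (p.2 : ℝ)| ∂γ

/-- The Wasserstein distance of order one, with values in `[0, ∞]`. -/
def wasserstein1 {Y : Set ℝ} (μ ν : Measure Y) : ℝ≥0∞ :=
  ⨅ γ ∈ couplings μ ν, transportCost γ

/-- The marginal on `X i` of a probability measure on `X₁ × ⋯ × X_N × S`. -/
def augMarginal {N K : ℕ} {X : Fin N → Set ℝ} {S : Set (Fin K → ℝ)}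
    (P : ProbabilityMeasure (AugSpace X S)) (i : Fin N) : Measure (X i) :=
  (P : Measure (AugSpace X S)).map (fun p => p.1 i)

/-- The probability measures on `X₁ × ⋯ × X_N × S` with marginals `μ₁, …, μ_N` on
`X₁, …, X_N`. -/
def augCouplings {N K : ℕ} {X : Fin N → Set ℝ} (S : Set (Fin K → ℝ))
    (μ : ∀ i, ProbabilityMeasure (X i)) : Set (ProbabilityMeasure (AugSpace X S)) :=
  {Q | ∀ i, augMarginal Q i = (μ i : Measure (X i))}

/-- The space `(X₁ × ⋯ × X_N) × (X₁ × ⋯ × X_N) × S`, with two copies of each `X i`. -/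
abbrev DoubleAugSpace {N K : ℕ} (X : Fin N → Set ℝ) (S : Set (Fin K → ℝ)) : Type :=
  (∀ i, X i) × (∀ i, X i) × S

/-- The marginal on the first copy of `X₁ × ⋯ × X_N` and on `S`. -/
def firstMarginal {N K : ℕ} {X : Fin N → Set ℝ} {S : Set (Fin K → ℝ)}
    (γ : Measure (DoubleAugSpace X S)) : Measure (AugSpace X S) :=
  γ.map (fun p => (p.1, p.2.2))

/-- The marginal on the second copy of `X₁ × ⋯ × X_N` and on `S`. -/
def secondMarginal {N K : ℕ} {X : Fin N → Set ℝ} {S : Set (Fin K → ℝ)}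
    (γ : Measure (DoubleAugSpace X S)) : Measure (AugSpace X S) :=
  γ.map (fun p => (p.2.1, p.2.2))

/-- The marginal on the two copies of `X i`. -/
def pairMarginal {N K : ℕ} {X : Fin N → Set ℝ} {S : Set (Fin K → ℝ)}
    (γ : Measure (DoubleAugSpace X S)) (i : Fin N) : Measure (X i × X i) :=
  γ.map (fun p => (p.1 i, p.2.1 i))

/-- The set of partial reassemblies of `P` with marginals `μ₁, …, μ_N`. -/
def partialReassemblies {N K : ℕ} {X : Fin N → Set ℝ} {S : Set (Fin K → ℝ)}
    (P : ProbabilityMeasure (AugSpace X S)) (μ : ∀ i, ProbabilityMeasure (X i)) :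
    Set (ProbabilityMeasure (AugSpace X S)) :=
  {Q | Q ∈ augCouplings S μ ∧
    ∃ γ : ProbabilityMeasure (DoubleAugSpace X S),
      firstMarginal (γ : Measure (DoubleAugSpace X S)) = (P : Measure (AugSpace X S)) ∧
      (∀ i, pairMarginal (γ : Measure (DoubleAugSpace X S)) i ∈
          couplings (augMarginal P i) (μ i : Measure (X i)) ∧
        transportCost (pairMarginal (γ : Measure (DoubleAugSpace X S)) i) =
          wasserstein1 (augMarginal P i) (μ i : Measure (X i))) ∧
      secondMarginal (γ : Measure (DoubleAugSpace X S)) = (Q : Measure (AugSpace X S))}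

end

/-! Everything rests on quantile functions `q_m`: off the endpoints, `q_m u ≤ x` iff `u` is at most
the distribution function of `m` at `x`. So if `v` has uniform marginals and its law has
distribution function `C`, the vector of the `q_{m_k} (v k)` has distribution function `C` composed
with those of the `m_k` (`map_quantile_pi_real`). Part (i) is Sklar's theorem:
`exists_map_quantile_eq` produces such a `v`, drawing each `v k` from the conditional law of a
uniform variable given its quantile. For (ii), one `v` drives two vectors: `q v`, with the law of
the given measure, and `q' v`, where the first `N` quantile functions are those of the `μ i`. The
last `K` coordinates agree, so the `S`-component is shared. In each of the first `N`, both vectors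
are quantiles of the same uniform variable: this comonotone coupling is optimal for `|x - y|`.
Uniqueness holds because orthants determine a law. -/

open ProbabilityTheory Set in
theorem unitInterval_ae_mem_Ioo : ∀ᵐ u : unitInterval, u ∈ Ioo (0 : unitInterval) 1 := by
  have h0 : ∀ᵐ u : unitInterval, u ≠ 0 := by simp [ae_iff]
  have h1 : ∀ᵐ u : unitInterval, u ≠ 1 := by simp [ae_iff]
  filter_upwards [h0, h1] with u hu0 hu1
  exact ⟨unitInterval.pos_iff_ne_zero.2 hu0, unitInterval.lt_one_iff_ne_one.2 hu1⟩

/-- The quantile function of a measure on `ℝ`. -/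
noncomputable def quantile (m : Measure ℝ) (u : unitInterval) : ℝ :=
  sInf {x | (u : ℝ) ≤ ProbabilityTheory.cdf m x}

-- Right continuity of the cdf makes the infimum attained. The endpoints are excluded because `sInf`
-- takes its default value `0` at `u = 0`, where the set is all of `ℝ`, and possibly at `u = 1`,
-- where it may be empty.
open ProbabilityTheory Set Filter Topology in
theorem quantile_le_iff (m : Measure ℝ) {u : unitInterval}
    (hu : u ∈ Ioo (0 : unitInterval) 1) (x : ℝ) :
    quantile m u ≤ x ↔ (u : ℝ) ≤ cdf m x := by
  have hu0 : (0 : ℝ) < u := hu.1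
  have hu1 : (u : ℝ) < 1 := hu.2
  obtain ⟨a, ha⟩ := ((tendsto_cdf_atBot m).eventually (gt_mem_nhds hu0)).exists
  obtain ⟨b, hb⟩ := ((tendsto_cdf_atTop m).eventually (lt_mem_nhds hu1)).exists
  have hbdd : BddBelow {x | (u : ℝ) ≤ cdf m x} := by
    refine ⟨a, fun y hy => ?_⟩
    by_contra! h
    exact absurd (hy.trans (monotone_cdf m h.le)) (not_le.2 ha)
  refine ⟨fun h => ?_, fun h => csInf_le hbdd h⟩
  have hright : Tendsto (cdf m) (𝓝[>] x) (𝓝 (cdf m x)) :=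
    ((cdf m).right_continuous x).mono Ioi_subset_Ici_self
  refine ge_of_tendsto hright (eventually_nhdsWithin_of_forall fun y hy => ?_)
  obtain ⟨w, hw, hwy⟩ := exists_lt_of_csInf_lt ⟨b, hb.le⟩ (lt_of_le_of_lt h hy)
  exact le_trans hw (monotone_cdf m hwy.le)

open Set in
theorem measurable_quantile (m : Measure ℝ) : Measurable (quantile m) := by
  refine measurable_of_Iic fun x => ?_
  have hsplit : quantile m ⁻¹' Iic x =
      ({u : unitInterval | (u : ℝ) ≤ ProbabilityTheory.cdf m x} ∩ Ioo 0 1) ∪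
        (quantile m ⁻¹' Iic x ∩ (Ioo 0 1)ᶜ) := by
    rw [← inter_union_compl (quantile m ⁻¹' Iic x) (Ioo 0 1)]
    congr 1
    · ext u
      simp only [mem_inter_iff, mem_preimage, mem_Iic, mem_ofPred_eq]
      exact ⟨fun h => ⟨(quantile_le_iff m (by grind) x).1 (by grind), by grind⟩,
        fun h => by simpa [h.2.1, h.2.2] using (quantile_le_iff m h.2 x).2 h.1⟩
    · ext u
      simp
  rw [hsplit]
  refine ((measurableSet_le measurable_subtype_coe measurable_const).inter
    measurableSet_Ioo).union (Set.Finite.measurableSet ?_)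
  refine Set.Finite.subset (Set.toFinite {0, 1}) fun u hu => ?_
  have := hu.2
  simp only [mem_compl_iff, mem_Ioo, not_and, not_lt] at this
  by_cases h : 0 < u
  · right; exact le_antisymm unitInterval.le_one' (this h)
  · left; exact le_antisymm (not_lt.1 h) unitInterval.nonneg'

open Set in
theorem map_quantile (m : Measure ℝ) [IsProbabilityMeasure m] :
    volume.map (quantile m) = m := by
  have : IsProbabilityMeasure ((volume : Measure unitInterval).map (quantile m)) :=
    Measure.isProbabilityMeasure_map (measurable_quantile m).aemeasurable
  refine Measure.ext_of_Iic _ _ fun x => ?_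
  rw [Measure.map_apply (measurable_quantile m) measurableSet_Iic, ← ProbabilityTheory.ofReal_cdf]
  have : quantile m ⁻¹' Iic x =ᵐ[volume] Iic (⟨ProbabilityTheory.cdf m x,
      ProbabilityTheory.cdf_nonneg m x, ProbabilityTheory.cdf_le_one m x⟩ : unitInterval) := by
    filter_upwards [unitInterval_ae_mem_Ioo] with u hu
    exact propext (quantile_le_iff m hu x)
  rw [measure_congr this, unitInterval.volume_Iic]

/-- The null set consists of the two endpoints and so serves all `z` at once; `z = ⊥` is where `0 <
u` is needed. -/
theorem ae_quantile_le_iff (m : Measure ℝ) [IsProbabilityMeasure m] :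
    ∀ᵐ u : unitInterval, ∀ z : EReal,
      (quantile m u : EReal) ≤ z ↔ (u : ℝ) ≤ m.real {x | (x : EReal) ≤ z} := by
  filter_upwards [unitInterval_ae_mem_Ioo] with u hu z
  induction z with
  | bot => simpa using hu.1
  | top => simpa using u.2.2
  | coe z =>
    simp only [EReal.coe_le_coe_iff]
    rw [quantile_le_iff m hu, ProbabilityTheory.cdf_eq_real]
    rfl

open Set in
theorem Measure.pi_ext_of_Iic {ι : Type*} [Fintype ι] {P Q : Measure (ι → ℝ)}
    [IsProbabilityMeasure P] [IsProbabilityMeasure Q] (h : ∀ a, P (Iic a) = Q (Iic a)) :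
    P = Q := by
  have hspan : IsCountablySpanning (range (Iic : ℝ → Set ℝ)) := by
    refine ⟨fun n : ℕ => Iic (n : ℝ), fun n => ⟨_, rfl⟩, ?_⟩
    refine eq_univ_of_forall fun x => mem_iUnion.2 ?_
    exact exists_nat_ge x
  refine ext_of_generate_finite _
    (generateFrom_eq_pi (C := fun _ : ι => range (Iic : ℝ → Set ℝ)) (fun _ => ?_)
      fun _ => hspan).symm
    (IsPiSystem.pi (C := fun _ : ι => range (Iic : ℝ → Set ℝ)) fun _ => ?_) ?_ (by simp)
  · rw [← borel_eq_generateFrom_Iic ℝ]; exact (BorelSpace.measurable_eq (α := ℝ)).symm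
  · exact isPiSystem_Iic
  · rintro _ ⟨s, hs, rfl⟩
    choose a ha using fun i => hs i (mem_univ i)
    obtain rfl : (fun i => Iic (a i)) = s := funext ha
    rw [pi_univ_Iic]
    exact h a

/-! ### Transport cost on the line -/

-- The positive part of `f - g` is the length of `[g, f)`; Tonelli then exchanges `ω` and the level
-- `t`.
open Set in
theorem lintegral_abs_sub_eq {Ω : Type*} [MeasurableSpace Ω] (ρ : Measure Ω) [SFinite ρ]
    {f g : Ω → ℝ} (hf : Measurable f) (hg : Measurable g) :
    ∫⁻ ω, ENNReal.ofReal |f ω - g ω| ∂ρ =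
      (∫⁻ t, ρ ({ω | g ω ≤ t} \ {ω | f ω ≤ t})) + ∫⁻ t, ρ ({ω | f ω ≤ t} \ {ω | g ω ≤ t}) := by
  have key : ∀ {f g : Ω → ℝ}, Measurable f → Measurable g →
      ∫⁻ ω, ENNReal.ofReal (f ω - g ω) ∂ρ = ∫⁻ t, ρ ({ω | g ω ≤ t} \ {ω | f ω ≤ t}) := by
    intro f g hf hg
    have hm : MeasurableSet {p : Ω × ℝ | g p.1 ≤ p.2 ∧ p.2 < f p.1} :=
      (measurableSet_le (hg.comp measurable_fst) measurable_snd).inter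
        (measurableSet_lt measurable_snd (hf.comp measurable_fst))
    calc ∫⁻ ω, ENNReal.ofReal (f ω - g ω) ∂ρ = ∫⁻ ω, volume (Ico (g ω) (f ω)) ∂ρ := by
          simp only [Real.volume_Ico]
      _ = (ρ.prod volume) {p : Ω × ℝ | g p.1 ≤ p.2 ∧ p.2 < f p.1} := by
          rw [Measure.prod_apply hm]; rfl
      _ = _ := by
          rw [Measure.prod_apply_symm hm]
          congr with t
          congr 1
          ext ω
          simp
  rw [← key hf hg, ← key hg hf, ← lintegral_add_left (by fun_prop)]
  congr with ω
  rcases le_total (f ω) (g ω) with h | h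
  · rw [abs_of_nonpos (sub_nonpos.2 h), ENNReal.ofReal_of_nonpos (sub_nonpos.2 h), zero_add,
      neg_sub]
  · rw [abs_of_nonneg (sub_nonneg.2 h), ENNReal.ofReal_of_nonpos (sub_nonpos.2 h), add_zero]

-- Both sublevel sets are, up to endpoints, initial segments of `[0,1]`, hence nested: the
-- difference is null or has exactly the difference of the masses. Subtraction in `ℝ≥0∞` truncates
-- at `0`, which covers both cases.
open Set in
theorem volume_quantile_diff_le (m n : Measure ℝ) [IsProbabilityMeasure m]
    [IsProbabilityMeasure n] (t : ℝ) :
    volume ({u | quantile n u ≤ t} \ {u | quantile m u ≤ t}) ≤ n (Iic t) - m (Iic t) := by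
  have hmeas : ∀ m : Measure ℝ, MeasurableSet {u | quantile m u ≤ t} := fun m =>
    measurable_quantile m measurableSet_Iic
  have hvol : ∀ (m : Measure ℝ) [IsProbabilityMeasure m],
      volume {u | quantile m u ≤ t} = m (Iic t) := by
    intro m _
    conv_rhs => rw [← map_quantile m, Measure.map_apply (measurable_quantile m) measurableSet_Iic]
    rfl
  rcases le_total (ProbabilityTheory.cdf n t) (ProbabilityTheory.cdf m t) with h | h
  · refine (le_of_eq ?_).trans zero_le
    refine measure_mono_null (fun u hu => ?_) (ae_iff.1 unitInterval_ae_mem_Ioo)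
    intro hI
    exact hu.2 ((quantile_le_iff m hI t).2 (((quantile_le_iff n hI t).1 hu.1).trans h))
  · rw [← hvol m, ← hvol n]
    refine (measure_sdiff' _ (hmeas m).nullMeasurableSet (measure_ne_top _ _)).trans_le ?_
    refine tsub_le_tsub_right ?_ _
    refine measure_mono_ae ?_
    filter_upwards [unitInterval_ae_mem_Ioo] with u hI hu
    rcases hu with hu | hu
    · exact hu
    · exact (quantile_le_iff n hI t).2 (((quantile_le_iff m hI t).1 hu).trans h)

-- At each level `t`, every coupling gives the set differences at least the truncated difference of
-- the masses, and the quantile coupling gives them no more.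
open Set in
theorem lintegral_quantile_le {π : Measure (ℝ × ℝ)} {m n : Measure ℝ} [IsProbabilityMeasure m]
    [IsProbabilityMeasure n] [IsFiniteMeasure π] (hm : π.map Prod.fst = m)
    (hn : π.map Prod.snd = n) :
    ∫⁻ u : unitInterval, ENNReal.ofReal |quantile m u - quantile n u| ≤
      ∫⁻ p, ENNReal.ofReal |p.1 - p.2| ∂π := by
  rw [lintegral_abs_sub_eq _ (measurable_quantile m) (measurable_quantile n),
    lintegral_abs_sub_eq _ measurable_fst measurable_snd]
  have hm' : ∀ t, m (Iic t) = π {p | p.1 ≤ t} := fun t => by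
    rw [← hm, Measure.map_apply measurable_fst measurableSet_Iic]; rfl
  have hn' : ∀ t, n (Iic t) = π {p | p.2 ≤ t} := fun t => by
    rw [← hn, Measure.map_apply measurable_snd measurableSet_Iic]; rfl
  gcongr with t t
  · refine (volume_quantile_diff_le m n t).trans ?_
    rw [hm', hn']
    exact le_measure_sdiff
  · refine (volume_quantile_diff_le n m t).trans ?_
    rw [hm', hn']
    exact le_measure_sdiff

/-! ### Sklar's theorem: uniform variables behind a given law -/

theorem Measure.map_prod_eq_compProd {α β γ : Type*} [MeasurableSpace α] [MeasurableSpace β]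
    [MeasurableSpace γ] (m : Measure α) [SFinite m] (n : Measure β) [SFinite n]
    (κ : ProbabilityTheory.Kernel α γ) [ProbabilityTheory.IsSFiniteKernel κ] {f : α → β → γ}
    (hf : Measurable (Function.uncurry f)) (h : ∀ a, n.map (f a) = κ a) :
    (m.prod n).map (fun p => (p.1, f p.1 p.2)) = m.compProd κ := by
  ext s hs
  have hmeas : Measurable fun p : α × β => (p.1, f p.1 p.2) := measurable_fst.prodMk hf
  rw [Measure.map_apply hmeas hs, Measure.prod_apply (hmeas hs), Measure.compProd_apply hs]
  congr with a
  rw [← h a, Measure.map_apply hf.of_uncurry_left (measurable_prodMk_left hs)]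
  rfl

/-- Every probability measure on a finite power of `ℝ` is the image, under the quantile functions of
its marginals, of a probability measure on the cube with uniform marginals. -/
theorem exists_map_quantile_eq {ι : Type*} [Fintype ι] (Q : Measure (ι → ℝ))
    [IsProbabilityMeasure Q] :
    ∃ P : Measure (ι → unitInterval), IsProbabilityMeasure P ∧
      (∀ k, P.map (fun v => v k) = volume) ∧
      P.map (fun v k => quantile (Q.map fun x => x k) (v k)) = Q := by
  have hm : ∀ k, IsProbabilityMeasure (Q.map fun x => x k) := fun k =>
    Measure.isProbabilityMeasure_map (measurable_pi_apply k).aemeasurable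
  set q : ι → unitInterval → ℝ := fun k => quantile (Q.map fun x => x k)
  have hqm : ∀ k, Measurable (q k) := fun k => measurable_quantile _
  have hqid : ∀ k, Measurable fun u => (q k u, u) := fun k => (hqm k).prodMk measurable_id
  -- Disintegrating `ρ k` over its first coordinate gives the law of `u` given its quantile, which
  -- spreads each atom over an interval of levels. Below, `f k` realises this kernel from uniform
  -- noise independent of `x`.
  let ρ : ι → Measure (ℝ × unitInterval) := fun k => volume.map fun u => (q k u, u)
  have hρ : ∀ k, IsProbabilityMeasure (ρ k) := fun k =>
    Measure.isProbabilityMeasure_map (hqid k).aemeasurable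
  have hρfst : ∀ k, (ρ k).fst = Q.map fun x => x k := fun k => by
    rw [Measure.fst, Measure.map_map measurable_fst (hqid k)]
    exact map_quantile _
  have hρsnd : ∀ k, (ρ k).map Prod.snd = volume := fun k => by
    rw [Measure.map_map measurable_snd (hqid k)]
    exact Measure.map_id
  choose f hf hfκ using fun k => ((ρ k).condKernel).exists_measurable_map_eq_unitInterval
  let R : Measure ((ι → ℝ) × (ι → unitInterval)) := Q.prod (Measure.pi fun _ => volume)
  let U : (ι → ℝ) × (ι → unitInterval) → ι → unitInterval := fun p k => f k (p.1 k) (p.2 k)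
  have hfp : ∀ k, Measurable fun p : ℝ × unitInterval => (p.1, f k p.1 p.2) := fun k =>
    measurable_fst.prodMk (hf k)
  have hpair : ∀ k, Measurable fun p : (ι → ℝ) × (ι → unitInterval) => (p.1 k, p.2 k) :=
    fun k => ((measurable_pi_apply k).comp measurable_fst).prodMk
      ((measurable_pi_apply k).comp measurable_snd)
  have hU : Measurable U := measurable_pi_lambda _ fun k => (hf k).comp (hpair k)
  have hlaw : ∀ k, R.map (fun p => (p.1 k, U p k)) = ρ k := by
    intro k
    have h1 : R.map (fun p => (p.1 k, p.2 k)) = (Q.map fun x => x k).prod volume := by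
      have := Measure.map_prod_map Q (Measure.pi fun _ : ι => (volume : Measure unitInterval))
        (measurable_pi_apply k) (measurable_pi_apply k)
      rw [(measurePreserving_eval (fun _ : ι => (volume : Measure unitInterval)) k).map_eq] at this
      exact this.symm
    calc R.map (fun p => (p.1 k, U p k))
        = (R.map (fun p => (p.1 k, p.2 k))).map fun p => (p.1, f k p.1 p.2) :=
          (Measure.map_map (hfp k) (hpair k)).symm
      _ = ((ρ k).fst).compProd (ρ k).condKernel := by
          rw [h1, Measure.map_prod_eq_compProd _ _ _ (hf k) (hfκ k), hρfst]
      _ = ρ k := (ρ k).disintegrate _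
  have hxU : ∀ k, Measurable fun p : (ι → ℝ) × (ι → unitInterval) => (p.1 k, U p k) := fun k =>
    (hfp k).comp (hpair k)
  refine ⟨R.map U, Measure.isProbabilityMeasure_map hU.aemeasurable, fun k => ?_, ?_⟩
  · rw [Measure.map_map (measurable_pi_apply k) hU, ← hρsnd k, ← hlaw k,
      Measure.map_map measurable_snd (hxU k)]
    rfl
  · have hae : ∀ᵐ p ∂(R), ∀ k, q k (U p k) = p.1 k := by
      refine ae_all_iff.2 fun k => ?_
      have hset : MeasurableSet {p : ℝ × unitInterval | q k p.2 = p.1} :=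
        measurableSet_eq_fun ((hqm k).comp measurable_snd) measurable_fst
      have : ∀ᵐ p ∂(ρ k), q k p.2 = p.1 :=
        (ae_map_iff (hqid k).aemeasurable hset).2 (Filter.Eventually.of_forall fun _ => rfl)
      rw [← hlaw k] at this
      exact ae_of_ae_map (hxU k).aemeasurable this
    refine (Measure.map_map
      (measurable_pi_lambda _ fun k => (hqm k).comp (measurable_pi_apply k)) hU).trans ?_
    have : (fun p => fun k => q k (U p k)) =ᵐ[R] Prod.fst := by
      filter_upwards [hae] with p hp
      exact funext hp
    refine (Measure.map_congr this).trans ?_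
    simp [R, Measure.map_fst_prod]

/-! ### Passage between Euclidean space and its subspaces -/

theorem exists_measurable_retraction {α : Type*} [MeasurableSpace α] {Y : Set α}
    (hY : MeasurableSet Y) (hne : Y.Nonempty) :
    ∃ r : α → Y, Measurable r ∧ ∀ y : Y, r y = y := by
  obtain ⟨r, hr, hrid⟩ := (MeasurableEmbedding.subtype_coe hY).exists_measurable_extend
    (measurable_id (α := Y)) fun _ => hne.to_subtype
  exact ⟨r, hr, fun y => congrFun hrid y⟩

theorem IsPolytope.measurableSet {K : ℕ} {S : Set (Fin K → ℝ)} (hS : IsPolytope S) :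
    MeasurableSet S := by
  obtain ⟨m, A, b, rfl⟩ := hS.1
  exact (isClosed_le (Continuous.matrix_mulVec continuous_const continuous_id)
    continuous_const).measurableSet

theorem measurable_augCoord {N K : ℕ} {X : Fin N → Set ℝ} {S : Set (Fin K → ℝ)} :
    Measurable (augCoord : AugSpace X S → Fin N ⊕ Fin K → ℝ) := by
  refine measurable_pi_lambda _ fun k => ?_
  cases k with
  | inl i => exact measurable_subtype_coe.comp ((measurable_pi_apply i).comp measurable_fst)
  | inr j => exact (measurable_pi_apply j).comp (measurable_subtype_coe.comp measurable_snd)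

theorem measurableSet_le_ereal {ι : Type*} [Countable ι] (z : ι → EReal) :
    MeasurableSet {x : ι → ℝ | ∀ k, (x k : EReal) ≤ z k} :=
  MeasurableSet.congr (MeasurableSet.iInter (f := fun k => {x : ι → ℝ | (x k : EReal) ≤ z k})
    fun k => measurableSet_le (measurable_coe_real_ereal.comp (measurable_pi_apply k))
      measurable_const) (by ext; simp)

theorem measurableSet_real_le_ereal (z : EReal) : MeasurableSet {x : ℝ | (x : EReal) ≤ z} :=
  measurableSet_le measurable_coe_real_ereal measurable_const

theorem ae_quantile_pi_le_iff {ι : Type*} [Countable ι] {P : Measure (ι → unitInterval)}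
    (hP : ∀ k, P.map (fun v => v k) = volume) (m : ι → Measure ℝ)
    [∀ k, IsProbabilityMeasure (m k)] :
    ∀ᵐ v ∂P, ∀ z : ι → EReal, (∀ k, (quantile (m k) (v k) : EReal) ≤ z k) ↔
      ∀ k, (v k : ℝ) ≤ (m k).real {x | (x : EReal) ≤ z k} := by
  have : ∀ᵐ v ∂P, ∀ k, ∀ z : EReal,
      (quantile (m k) (v k) : EReal) ≤ z ↔ (v k : ℝ) ≤ (m k).real {x | (x : EReal) ≤ z} := by
    refine ae_all_iff.2 fun k => ae_of_ae_map (f := fun v : ι → unitInterval => v k)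
      (measurable_pi_apply k).aemeasurable
      (p := fun u : unitInterval => ∀ z : EReal,
        (quantile (m k) u : EReal) ≤ z ↔ (u : ℝ) ≤ (m k).real {x | (x : EReal) ≤ z}) ?_
    rw [hP k]
    exact ae_quantile_le_iff (m k)
  filter_upwards [this] with v hv z
  exact forall_congr' fun k => hv k (z k)

/-! ### Coordinate laws and distribution functions in copula form -/

section
variable {N K : ℕ} {X : Fin N → Set ℝ} {S : Set (Fin K → ℝ)}

theorem jointDistFun_coe (P : ProbabilityMeasure (AugSpace X S)) (z : Fin N ⊕ Fin K → EReal) :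
    (jointDistFun P z : ℝ) =
      ((P : Measure (AugSpace X S)).map augCoord).real {x | ∀ k, (x k : EReal) ≤ z k} :=
  (map_measureReal_apply measurable_augCoord (measurableSet_le_ereal z)).symm

/-- The law of the `k`-th coordinate. -/
noncomputable def coordLaw (P : ProbabilityMeasure (AugSpace X S)) (k : Fin N ⊕ Fin K) : Measure ℝ :=
  ((P : Measure (AugSpace X S)).map augCoord).map fun x => x k

instance (P : ProbabilityMeasure (AugSpace X S)) :
    IsProbabilityMeasure ((P : Measure (AugSpace X S)).map augCoord) :=
  Measure.isProbabilityMeasure_map measurable_augCoord.aemeasurable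

instance (P : ProbabilityMeasure (AugSpace X S)) (k : Fin N ⊕ Fin K) :
    IsProbabilityMeasure (coordLaw P k) :=
  Measure.isProbabilityMeasure_map (measurable_pi_apply k).aemeasurable

theorem coordLaw_eq_map (P : ProbabilityMeasure (AugSpace X S)) (k : Fin N ⊕ Fin K) :
    coordLaw P k = (P : Measure (AugSpace X S)).map fun p => augCoord p k :=
  Measure.map_map (measurable_pi_apply k) measurable_augCoord

theorem coordLaw_inl (P : ProbabilityMeasure (AugSpace X S)) (i : Fin N) :
    coordLaw P (Sum.inl i) = (augMarginal P i).map Subtype.val := by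
  rw [coordLaw_eq_map, augMarginal, Measure.map_map measurable_subtype_coe
    ((measurable_pi_apply i).comp measurable_fst)]
  rfl

theorem marginalDistFun_coe (P : ProbabilityMeasure (AugSpace X S)) (k : Fin N ⊕ Fin K)
    (z : EReal) : (marginalDistFun P k z : ℝ) = (coordLaw P k).real {x | (x : EReal) ≤ z} := by
  rw [coordLaw_eq_map]
  exact (map_measureReal_apply ((measurable_pi_apply k).comp measurable_augCoord)
    (measurableSet_real_le_ereal z)).symm

theorem distFun_coe {Y : Set ℝ} (ν : ProbabilityMeasure Y) (z : EReal) :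
    (distFun ν z : ℝ) = ((ν : Measure Y).map Subtype.val).real {x | (x : EReal) ≤ z} :=
  (map_measureReal_apply measurable_subtype_coe (measurableSet_real_le_ereal z)).symm

theorem measurable_quantile_pi {ι : Type*} (m : ι → Measure ℝ) :
    Measurable fun (v : ι → unitInterval) k => quantile (m k) (v k) :=
  measurable_pi_lambda _ fun k => (measurable_quantile (m k)).comp (measurable_pi_apply k)

theorem map_quantile_pi_real {ι : Type*} [Countable ι] {P : Measure (ι → unitInterval)}
    (hP : ∀ k, P.map (fun v => v k) = volume) (m : ι → Measure ℝ)
    [∀ k, IsProbabilityMeasure (m k)] (z : ι → EReal) :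
    (P.map fun v k => quantile (m k) (v k)).real {x | ∀ k, (x k : EReal) ≤ z k} =
      P.real {v | ∀ k, (v k : ℝ) ≤ (m k).real {x | (x : EReal) ≤ z k}} := by
  rw [map_measureReal_apply (measurable_quantile_pi m) (measurableSet_le_ereal z)]
  refine measureReal_congr ?_
  filter_upwards [ae_quantile_pi_le_iff hP m] with v hv
  exact propext (hv z)

theorem exists_isCopulaOf (P : ProbabilityMeasure (AugSpace X S)) :
    ∃ C : (Fin N ⊕ Fin K → unitInterval) → unitInterval, IsCopulaOf C P := by
  obtain ⟨R, hR, hRu, hRP⟩ := exists_map_quantile_eq ((P : Measure (AugSpace X S)).map augCoord)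
  refine ⟨fun u => probUnit ⟨R, hR⟩ {v | ∀ k, v k ≤ u k}, ⟨⟨R, hR⟩, hRu, fun _ => rfl⟩,
    fun z => Subtype.ext ?_⟩
  rw [jointDistFun_coe]
  conv_lhs => rw [← hRP]
  refine (map_quantile_pi_real hRu (coordLaw P) z).trans ?_
  simp only [← marginalDistFun_coe]
  rfl

theorem map_augCoord_eq_of_jointDistFun {P : ProbabilityMeasure (AugSpace X S)}
    {Q : Measure (Fin N ⊕ Fin K → ℝ)} [IsProbabilityMeasure Q]
    (h : ∀ z, (jointDistFun P z : ℝ) = Q.real {x | ∀ k, (x k : EReal) ≤ z k}) :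
    (P : Measure (AugSpace X S)).map augCoord = Q := by
  refine Measure.pi_ext_of_Iic fun a => ?_
  have := h fun k => (a k : EReal)
  rw [jointDistFun_coe] at this
  simp only [EReal.coe_le_coe_iff] at this
  exact (measureReal_eq_measureReal_iff (measure_ne_top _ _) (measure_ne_top _ _)).1 this

/-- The coordinate laws of a reassembly. -/
noncomputable def reassembledLaw (μ : ∀ i, ProbabilityMeasure (X i)) (P : ProbabilityMeasure (AugSpace X S)) :
    Fin N ⊕ Fin K → Measure ℝ :=
  Sum.elim (fun i => (μ i : Measure (X i)).map Subtype.val) fun j => coordLaw P (Sum.inr j)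

instance (μ : ∀ i, ProbabilityMeasure (X i)) (P : ProbabilityMeasure (AugSpace X S))
    (k : Fin N ⊕ Fin K) : IsProbabilityMeasure (reassembledLaw μ P k) := by
  cases k with
  | inl i => exact Measure.isProbabilityMeasure_map measurable_subtype_coe.aemeasurable
  | inr j => exact inferInstanceAs (IsProbabilityMeasure (coordLaw P (Sum.inr j)))

theorem reassembledDistFun_coe {C : (Fin N ⊕ Fin K → unitInterval) → unitInterval}
    {R : ProbabilityMeasure (Fin N ⊕ Fin K → unitInterval)}
    (hR : ∀ k, (R : Measure (Fin N ⊕ Fin K → unitInterval)).map (fun v => v k) = volume)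
    (hC : ∀ u, C u = probUnit R {v | ∀ k, v k ≤ u k}) (μ : ∀ i, ProbabilityMeasure (X i))
    (P : ProbabilityMeasure (AugSpace X S)) (z : Fin N ⊕ Fin K → EReal) :
    (reassembledDistFun C μ P z : ℝ) =
      ((R : Measure (Fin N ⊕ Fin K → unitInterval)).map
        fun v k => quantile (reassembledLaw μ P k) (v k)).real {x | ∀ k, (x k : EReal) ≤ z k} := by
  rw [map_quantile_pi_real hR, reassembledDistFun, hC]
  change Measure.real _ _ = _
  congr 1
  ext v
  refine forall_congr' fun k => ?_
  rw [← Subtype.coe_le_coe]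
  cases k with
  | inl i => rw [Sum.elim_inl, distFun_coe]; rfl
  | inr j => rw [Sum.elim_inr, marginalDistFun_coe]; rfl

theorem map_quantile_coordLaw {C : (Fin N ⊕ Fin K → unitInterval) → unitInterval}
    {R : ProbabilityMeasure (Fin N ⊕ Fin K → unitInterval)}
    (hR : ∀ k, (R : Measure (Fin N ⊕ Fin K → unitInterval)).map (fun v => v k) = volume)
    (hC : ∀ u, C u = probUnit R {v | ∀ k, v k ≤ u k}) {P : ProbabilityMeasure (AugSpace X S)}
    (hCP : ∀ z, jointDistFun P z = C fun k => marginalDistFun P k (z k)) :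
    (R : Measure (Fin N ⊕ Fin K → unitInterval)).map
      (fun v k => quantile (coordLaw P k) (v k)) = (P : Measure (AugSpace X S)).map augCoord := by
  have : IsProbabilityMeasure ((R : Measure (Fin N ⊕ Fin K → unitInterval)).map
      fun v k => quantile (coordLaw P k) (v k)) :=
    Measure.isProbabilityMeasure_map (measurable_quantile_pi _).aemeasurable
  refine (map_augCoord_eq_of_jointDistFun fun z => ?_).symm
  rw [map_quantile_pi_real hR, hCP, hC]
  simp only [← marginalDistFun_coe]
  rfl

theorem map_quantile_comp_eval {ι : Type*} {R : Measure (ι → unitInterval)} {k : ι}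
    (hR : R.map (fun v => v k) = volume) (m : Measure ℝ) [IsProbabilityMeasure m] :
    R.map (fun v => quantile m (v k)) = m := by
  refine (Measure.map_map (measurable_quantile m) (measurable_pi_apply k)).symm.trans ?_
  rw [hR, map_quantile]

/-- The comonotone coupling is optimal. -/
theorem transportCost_quantile {Y : Set ℝ} {μ ν : Measure Y} [IsProbabilityMeasure μ]
    [IsProbabilityMeasure ν] {r : ℝ → Y} (hr : Measurable r) (hrid : ∀ y : Y, r y = y)
    {γ : Measure (Y × Y)}
    (hγ : γ = (volume : Measure unitInterval).map fun u =>
      (r (quantile (μ.map Subtype.val) u), r (quantile (ν.map Subtype.val) u))) :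
    γ ∈ couplings μ ν ∧ transportCost γ = wasserstein1 μ ν := by
  have hval : ∀ (ξ : Measure Y) [IsProbabilityMeasure ξ],
      IsProbabilityMeasure (ξ.map Subtype.val) := fun ξ _ =>
    Measure.isProbabilityMeasure_map measurable_subtype_coe.aemeasurable
  have hμ' := hval μ
  have hν' := hval ν
  have hq : ∀ ξ : Measure ℝ, Measurable fun u => r (quantile ξ u) := fun ξ =>
    hr.comp (measurable_quantile ξ)
  have hmap : ∀ (ξ : Measure Y) [IsProbabilityMeasure ξ],
      (volume : Measure unitInterval).map (fun u => r (quantile (ξ.map Subtype.val) u)) = ξ := by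
    intro ξ _
    have := hval ξ
    refine (Measure.map_map hr (measurable_quantile _)).symm.trans ?_
    rw [map_quantile, Measure.map_map hr measurable_subtype_coe]
    convert Measure.map_id
    exact funext hrid
  have hrq : ∀ (ξ : Measure Y) [IsProbabilityMeasure ξ], ∀ᵐ u : unitInterval,
      (r (quantile (ξ.map Subtype.val) u) : ℝ) = quantile (ξ.map Subtype.val) u := by
    intro ξ _
    have := hval ξ
    refine ae_of_ae_map (measurable_quantile (ξ.map Subtype.val)).aemeasurable
      (p := fun x => (r x : ℝ) = x) ?_
    rw [map_quantile]
    exact (ae_map_iff measurable_subtype_coe.aemeasurable (measurableSet_eq_fun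
      (measurable_subtype_coe.comp hr) measurable_id)).2
      (Filter.Eventually.of_forall fun y => congrArg Subtype.val (hrid y))
  have hmem : γ ∈ couplings μ ν := by
    subst hγ
    refine ⟨Measure.isProbabilityMeasure_map ((hq _).prodMk (hq _)).aemeasurable, ?_, ?_⟩
    · rw [Measure.map_map measurable_fst ((hq _).prodMk (hq _))]
      exact hmap μ
    · rw [Measure.map_map measurable_snd ((hq _).prodMk (hq _))]
      exact hmap ν
  refine ⟨hmem, le_antisymm (le_iInf₂ fun η hη => ?_) (iInf₂_le γ hmem)⟩
  obtain ⟨hη1, hηfst, hηsnd⟩ := hη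
  have hvv : Measurable fun p : Y × Y => ((p.1 : ℝ), (p.2 : ℝ)) := by fun_prop
  have hcost : ∀ θ : Measure (Y × Y), transportCost θ =
      ∫⁻ p, ENNReal.ofReal |p.1 - p.2| ∂(θ.map fun p : Y × Y => ((p.1 : ℝ), (p.2 : ℝ))) := by
    intro θ
    rw [lintegral_map (by fun_prop) hvv]
    rfl
  have hη2 : IsProbabilityMeasure (η.map fun p : Y × Y => ((p.1 : ℝ), (p.2 : ℝ))) :=
    Measure.isProbabilityMeasure_map hvv.aemeasurable
  rw [hcost η]
  calc transportCost γ = ∫⁻ u : unitInterval, ENNReal.ofReal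
        |quantile (μ.map Subtype.val) u - quantile (ν.map Subtype.val) u| := by
        rw [transportCost, hγ, lintegral_map (by fun_prop) ((hq _).prodMk (hq _))]
        refine lintegral_congr_ae ?_
        filter_upwards [hrq μ, hrq ν] with u h1 h2
        rw [h1, h2]
    _ ≤ _ := by
        refine lintegral_quantile_le ?_ ?_
        · rw [← hηfst, Measure.map_map measurable_fst hvv,
            Measure.map_map measurable_subtype_coe measurable_fst]
          rfl
        · rw [← hηsnd, Measure.map_map measurable_snd hvv,
            Measure.map_map measurable_subtype_coe measurable_snd]
          rfl

end

/-! ### Construction of the reassembly -/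

theorem proposition1 {N K : ℕ} (X : Fin N → Set ℝ) (hXne : ∀ i, (X i).Nonempty)
    (hX : ∀ i, IsCompact (X i)) (μ : ∀ i, ProbabilityMeasure (X i))
    (S : Set (Fin K → ℝ)) (hSne : S.Nonempty) (hS : IsPolytope S)
    (μhat : ProbabilityMeasure (AugSpace X S)) :
    (∃ C : (Fin N ⊕ Fin K → unitInterval) → unitInterval, IsCopulaOf C μhat) ∧
    ∀ C : (Fin N ⊕ Fin K → unitInterval) → unitInterval, IsCopulaOf C μhat →
      ∃ μtilde : ProbabilityMeasure (AugSpace X S),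
        (∀ z, jointDistFun μtilde z = reassembledDistFun C μ μhat z) ∧
        (∀ ν : ProbabilityMeasure (AugSpace X S),
          (∀ z, jointDistFun ν z = reassembledDistFun C μ μhat z) → ν = μtilde) ∧
        μtilde ∈ partialReassemblies μhat μ := by
  refine ⟨exists_isCopulaOf μhat, ?_⟩
  rintro C ⟨⟨R, hR, hC⟩, hCP⟩
  have hXm : ∀ i, MeasurableSet (X i) := fun i => (hX i).isClosed.measurableSet
  choose r hr hrid using fun i => exists_measurable_retraction (hXm i) (hXne i)
  obtain ⟨s, hs, hsid⟩ := exists_measurable_retraction hS.measurableSet hSne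
  let E : (Fin N ⊕ Fin K → ℝ) → AugSpace X S := fun x =>
    (fun i => r i (x (Sum.inl i)), s fun j => x (Sum.inr j))
  have hE : Measurable E := by
    refine (measurable_pi_lambda _ fun i => (hr i).comp (measurable_pi_apply _)).prodMk
      (hs.comp (measurable_pi_lambda _ fun j => measurable_pi_apply _))
  have hEid : ∀ p, E (augCoord p) = p := fun p =>
    Prod.ext (funext fun i => hrid i (p.1 i)) (hsid p.2)
  have hmapE : ∀ P : ProbabilityMeasure (AugSpace X S),
      ((P : Measure (AugSpace X S)).map augCoord).map E = P := by
    intro P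
    rw [Measure.map_map hE measurable_augCoord]
    convert Measure.map_id
    exact funext hEid
  let q : (Fin N ⊕ Fin K → unitInterval) → Fin N ⊕ Fin K → ℝ :=
    fun v k => quantile (coordLaw μhat k) (v k)
  let q' : (Fin N ⊕ Fin K → unitInterval) → Fin N ⊕ Fin K → ℝ :=
    fun v k => quantile (reassembledLaw μ μhat k) (v k)
  have hq : Measurable q := measurable_quantile_pi _
  have hq' : Measurable q' := measurable_quantile_pi _
  have hqE : (R : Measure (Fin N ⊕ Fin K → unitInterval)).map (E ∘ q) = μhat := by
    rw [← Measure.map_map hE hq, map_quantile_coordLaw hR hC hCP, hmapE]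
  have hq'1 : IsProbabilityMeasure ((R : Measure (Fin N ⊕ Fin K → unitInterval)).map q') :=
    Measure.isProbabilityMeasure_map hq'.aemeasurable
  have hsupp : ∀ᵐ v ∂(R : Measure (Fin N ⊕ Fin K → unitInterval)),
      augCoord (E (q' v)) = q' v := by
    have h1 : ∀ᵐ v ∂(R : Measure (Fin N ⊕ Fin K → unitInterval)), ∀ i,
        q' v (Sum.inl i) ∈ X i := by
      refine ae_all_iff.2 fun i => ae_of_ae_map
        ((measurable_pi_apply (Sum.inl i)).comp hq').aemeasurable (p := fun x => x ∈ X i) ?_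
      have : (R : Measure (Fin N ⊕ Fin K → unitInterval)).map
          ((fun x : Fin N ⊕ Fin K → ℝ => x (Sum.inl i)) ∘ q') =
            (μ i : Measure (X i)).map Subtype.val :=
        map_quantile_comp_eval (hR (Sum.inl i)) (reassembledLaw μ μhat (Sum.inl i))
      rw [this]
      exact (ae_map_iff measurable_subtype_coe.aemeasurable (hXm i)).2
        (Filter.Eventually.of_forall fun y => y.2)
    -- `S` constrains the last `K` coordinates jointly, so membership must come from the joint law
    -- of `q v`; `q'` agrees with `q` there by definition.
    have h2 : ∀ᵐ v ∂(R : Measure (Fin N ⊕ Fin K → unitInterval)),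
        (fun j => q v (Sum.inr j)) ∈ S := by
      have hmeas : MeasurableSet {x : Fin N ⊕ Fin K → ℝ | (fun j => x (Sum.inr j)) ∈ S} :=
        (measurable_pi_lambda _ fun j => measurable_pi_apply (Sum.inr j)) hS.measurableSet
      refine ae_of_ae_map hq.aemeasurable
        (p := fun x : Fin N ⊕ Fin K → ℝ => (fun j => x (Sum.inr j)) ∈ S) ?_
      rw [map_quantile_coordLaw hR hC hCP]
      exact (ae_map_iff measurable_augCoord.aemeasurable hmeas).2
        (Filter.Eventually.of_forall fun p => p.2.2)
    filter_upwards [h1, h2] with v hv1 hv2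
    funext k
    cases k with
    | inl i => exact congrArg Subtype.val (hrid i ⟨_, hv1 i⟩)
    | inr j => exact congrFun (congrArg Subtype.val (hsid ⟨_, hv2⟩)) j
  let μtilde : ProbabilityMeasure (AugSpace X S) :=
    ⟨(R : Measure (Fin N ⊕ Fin K → unitInterval)).map (E ∘ q'),
      Measure.isProbabilityMeasure_map (hE.comp hq').aemeasurable⟩
  have hlaw : (μtilde : Measure (AugSpace X S)).map augCoord =
      (R : Measure (Fin N ⊕ Fin K → unitInterval)).map q' :=
    (Measure.map_map measurable_augCoord (hE.comp hq')).trans (Measure.map_congr hsupp)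
  have hmarg : ∀ i, (R : Measure (Fin N ⊕ Fin K → unitInterval)).map
      (fun v => r i (q' v (Sum.inl i))) = μ i := by
    intro i
    refine (Measure.map_map (hr i) ((measurable_pi_apply (Sum.inl i)).comp hq')).symm.trans ?_
    have : (R : Measure (Fin N ⊕ Fin K → unitInterval)).map
        ((fun x : Fin N ⊕ Fin K → ℝ => x (Sum.inl i)) ∘ q') =
          (μ i : Measure (X i)).map Subtype.val :=
      map_quantile_comp_eval (hR (Sum.inl i)) (reassembledLaw μ μhat (Sum.inl i))
    rw [this, Measure.map_map (hr i) measurable_subtype_coe]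
    convert Measure.map_id
    exact funext (hrid i)
  have hT : Measurable fun v => ((E (q v)).1, E (q' v)) :=
    (measurable_fst.comp (hE.comp hq)).prodMk (hE.comp hq')
  refine ⟨μtilde, fun z => Subtype.ext ?_, fun ν hν => Subtype.ext ?_, fun i => ?_,
    ⟨(R : Measure (Fin N ⊕ Fin K → unitInterval)).map fun v => ((E (q v)).1, E (q' v)),
      Measure.isProbabilityMeasure_map hT.aemeasurable⟩, ?_, fun i => ?_, ?_⟩
  · rw [jointDistFun_coe, hlaw, reassembledDistFun_coe hR hC]
  · change (ν : Measure (AugSpace X S)) = μtilde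
    rw [← hmapE ν, ← hmapE μtilde, hlaw, map_augCoord_eq_of_jointDistFun fun z =>
      (congrArg Subtype.val (hν z)).trans (reassembledDistFun_coe hR hC μ μhat z)]
  · exact (Measure.map_map ((measurable_pi_apply i).comp measurable_fst)
      (hE.comp hq')).trans (hmarg i)
  -- The `S`-components of `E (q v)` and `E (q' v)` coincide definitionally, so the pair is `E (q
  -- v)` itself.
  · exact (Measure.map_map (measurable_fst.prodMk (measurable_snd.comp measurable_snd)) hT).trans hqE
  · have : IsProbabilityMeasure (augMarginal μhat i) :=
      Measure.isProbabilityMeasure_map ((measurable_pi_apply i).comp measurable_fst).aemeasurable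
    refine transportCost_quantile (hr i) (hrid i) ?_
    -- Both quantiles are evaluated at the same uniform coordinate `v (Sum.inl i)`, which is the
    -- comonotone coupling.
    rw [← coordLaw_inl, ← hR (Sum.inl i)]
    have hqi : ∀ m : Measure ℝ, Measurable fun u => r i (quantile m u) := fun m =>
      (hr i).comp (measurable_quantile m)
    rw [Measure.map_map ((hqi _).prodMk (hqi _)) (measurable_pi_apply (Sum.inl i))]
    exact Measure.map_map (((measurable_pi_apply i).comp measurable_fst).prodMk
      ((measurable_pi_apply i).comp (measurable_fst.comp measurable_snd))) hT
  · exact Measure.map_map ((measurable_fst.comp measurable_snd).prodMk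
      (measurable_snd.comp measurable_snd)) hT
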